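/- Let $(\mu_n,\mathcal S_n,L_n,\pi_n)_{n\ge1}$ be a family of irreducible and reversible continuous-time Markov chains on finite state spaces $\mathcal S_n$, with infinitesimal generator $L_n$, stationary distribution $\pi_n$ and initial distribution $\mu_n$. For $t\ge0$ and $\epsilon>0$ let $$d_{n,2}(\mu_n,t)=\Big(\sum_{y\in\mathcal S_n}\Big|\frac{\mu_n e^{tL_n}(y)}{\pi_n(y)}-1\Big|^2\pi_n(y)\Big)^{1/2},\qquad T_{n,2}(\mu_n,\epsilon)=\min\{t\ge0 : d_{n,2}(\mu_n,t)\le\epsilon\}.$$ The family has an $L^2$-cutoff with cutoff time $(t_n)$, where $t_n>0$ (for all large $n$), if $d_{n,2}(\mu_n,(1+a)t_n)\to0$ and $d_{n,2}(\mu_n,(1-a)t_n)\to\infty$ for every $a\in(0,1)$; it has an $L^2$-cutoff if it has one with some cutoff time. Let $0=\lambda_{n,0}\le\lambda_{n,1}\le\dots\le\lambda_{n,|\mathcal S_n|-1}$ be the eigenvalues of $-L_n$, repeated according to multiplicity, with $L^2(\pi_n)$-orthonormal right eigenvectors $\phi_{n,0}=\mathbf 1,\phi_{n,1},\dots,\phi_{n,|\mathcal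 S_n|-1}$. Write $\mu_n(\phi)=\sum_x\mu_n(x)\phi(x)$ and, for $c>0$, let $$j_n(c)=\min\Big\{j\ge1 : \sum_{i=1}^{j}|\mu_n(\phi_{n,i})|^2>c\Big\},\qquad \tau_n(c)=\max_{j_n(c)\le j\le|\mathcal S_n|-1}\frac{\log\big(1+\sum_{i=1}^{j}|\mu_n(\phi_{n,i})|^2\big)}{2\lambda_{n,j}}.$$ Assume that $$\pi_n(|\mu_n/\pi_n|^2)=\sum_{x\in\mathcal S_n}\Big|\frac{\mu_n(x)}{\pi_n(x)}\Big|^2\pi_n(x)\longrightarrow\infty\qquad(n\to\infty),$$ so that, for every $c>0$, $j_n(c)$ and $\tau_n(c)$ are well defined for all sufficiently large $n$. Then the following are equivalent. 1. The family has an $L^2$-cutoff. 2. For all $\epsilon>0$ and $c>0$, $T_{n,2}(\mu_n,\epsilon)\,\lambda_{n,j_n(c)}\to\infty$. 3. There is $\epsilon>0$ such that, for all $c>0$, $T_{n,2}(\mu_n,\epsilon)\,\lambda_{n,j_n(c)}\to\infty$. 4. For all $c>0$, $\tau_n(c)\,\lambda_{n,j_n(c)}\to\infty$. 5. For all $\tilde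 c>0$ and $c>0$, $\tau_n(\tilde c)\,\lambda_{n,j_n(c)}\to\infty$. 6. There is $\tilde c>0$ such that, for all $c>0$, $\tau_n(\tilde c)\,\lambda_{n,j_n(c)}\to\infty$. Moreover, if the family has an $L^2$-cutoff, then, as $n\to\infty$, - for every $c>0$, $(\tau_n(c))$ is a cutoff time; - for all $\epsilon,\delta,c>0$, $|T_{n,2}(\mu_n,\epsilon)-T_{n,2}(\mu_n,\delta)|=O\big(1/\lambda_{n,j_n(c)}\big)$; - for all $\epsilon,c>0$, $|T_{n,2}(\mu_n,\epsilon)-\tau_n(c)|=O\big(\sqrt{\tau_n(c)/\lambda_{n,j_n(c)}}\big)$. -/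

import Mathlib

open Filter Topology Asymptotics

noncomputable section

/-- An irreducible, reversible continuous-time Markov chain on a finite state space `S`, together
with an initial distribution: `L` is the infinitesimal generator, `π` the stationary distribution
and `μ` the initial distribution. -/
structure RevChain (S : Type*) [Fintype S] where
  μ : S → ℝ
  L : Matrix S S ℝ
  π : S → ℝ
  μ_nonneg : ∀ x, 0 ≤ μ x
  μ_sum : ∑ x, μ x = 1
  π_nonneg : ∀ x, 0 ≤ π x
  π_sum : ∑ x, π x = 1
  /-- Jump rates are nonnegative. -/
  rate_nonneg : ∀ x y, x ≠ y → 0 ≤ L x y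
  /-- The rows of a generator sum to zero. -/
  row_sum : ∀ x, ∑ y, L x y = 0
  /-- Every state can be reached from every state along jumps of positive rate. -/
  irreducible : ∀ x y, Relation.ReflTransGen (fun u v => u ≠ v ∧ 0 < L u v) x y
  /-- Detailed balance. -/
  reversible : ∀ x y, π x * L x y = π y * L y x

namespace RevChain

variable {S : Type*} [Fintype S]

/-- Detailed balance makes `π` a stationary distribution. -/
theorem stationary (C : RevChain S) : Matrix.vecMul C.π C.L = 0 := by
  funext y
  have h : ∑ x, C.π x * C.L x y = ∑ x, C.π y * C.L y x :=
    Finset.sum_congr rfl fun x _ => C.reversible x y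
  simp only [Matrix.vecMul, dotProduct, Pi.zero_apply]
  rw [h, ← Finset.mul_sum, C.row_sum, mul_zero]

/-- `π(|μ/π|²)`. -/
def initialMass (C : RevChain S) : ℝ :=
  ∑ x, |C.μ x / C.π x| ^ 2 * C.π x

/-- The transition semigroup `H_t = e^{tL}`. -/
def semigroup [DecidableEq S] (C : RevChain S) (t : ℝ) : Matrix S S ℝ :=
  NormedSpace.exp (t • C.L)

/-- The `L²`-distance `d₂(μ,t) = ‖μ H_t / π - 1‖_{L²(π)}`. -/
def dist2 [DecidableEq S] (C : RevChain S) (t : ℝ) : ℝ :=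
  Real.sqrt (∑ y, |Matrix.vecMul C.μ (C.semigroup t) y / C.π y - 1| ^ 2 * C.π y)

/-- The `L²`-mixing time `T₂(μ,ε) = min {t ≥ 0 | d₂(μ,t) ≤ ε}`. -/
def mixingTime [DecidableEq S] (C : RevChain S) (ε : ℝ) : ℝ :=
  sInf {t : ℝ | 0 ≤ t ∧ C.dist2 t ≤ ε}

/-- `lam 0 ≤ lam 1 ≤ … ≤ lam (|S|-1)` are the eigenvalues of `-L`, repeated according to
multiplicity, and `φ 0 = 1, φ 1, …, φ (|S|-1)` are corresponding `L²(π)`-orthonormal right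
eigenvectors (so `lam 0 = 0`). Only the values at indices `i < |S|` are constrained. -/
structure IsEigenbasis (C : RevChain S) (lam : ℕ → ℝ) (φ : ℕ → S → ℝ) : Prop where
  mono : ∀ i j, i ≤ j → j < Fintype.card S → lam i ≤ lam j
  eigen : ∀ i, i < Fintype.card S → Matrix.mulVec (-C.L) (φ i) = lam i • φ i
  zero : φ 0 = fun _ => 1
  orthonormal : ∀ i j, i < Fintype.card S → j < Fintype.card S →
    ∑ x, φ i x * φ j x * C.π x = if i = j then 1 else 0

/-- The partial sum `∑_{i=1}^j |μ(φ_i)|²`, where `μ(φ) = ∑_x μ(x) φ(x)`. -/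
def weightSum (C : RevChain S) (φ : ℕ → S → ℝ) (j : ℕ) : ℝ :=
  ∑ i ∈ Finset.Icc 1 j, |∑ x, C.μ x * φ i x| ^ 2

/-- `j(c) = min {1 ≤ j ≤ |S|-1 | ∑_{i=1}^j |μ(φ_i)|² > c}`; it is meaningful only when there is
such a `j`. -/
def jIndex (C : RevChain S) (φ : ℕ → S → ℝ) (c : ℝ) : ℕ :=
  sInf {j : ℕ | 1 ≤ j ∧ j < Fintype.card S ∧ c < C.weightSum φ j}

/-- `τ(c) = max_{j(c) ≤ j ≤ |S|-1} log (1 + ∑_{i=1}^j |μ(φ_i)|²) / (2 lam_j)`, a maximum over a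
finite set. -/
def tau (C : RevChain S) (lam : ℕ → ℝ) (φ : ℕ → S → ℝ) (c : ℝ) : ℝ :=
  sSup ((fun j : ℕ => Real.log (1 + C.weightSum φ j) / (2 * lam j)) ''
    {j : ℕ | C.jIndex φ c ≤ j ∧ j < Fintype.card S})

end RevChain

/-- `t` is an `L²`-cutoff time of the family `F`. A cutoff time is a sequence of positive reals,
where finitely many terms do not matter. -/
def IsL2CutoffTime {S : ℕ → Type*} [∀ n, Fintype (S n)] [∀ n, DecidableEq (S n)]
    (F : ∀ n, RevChain (S n)) (t : ℕ → ℝ) : Prop :=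
  (∀ᶠ n in atTop, 0 < t n) ∧
    ∀ a : ℝ, 0 < a → a < 1 →
      Tendsto (fun n => (F n).dist2 ((1 + a) * t n)) atTop (𝓝 0) ∧
      Tendsto (fun n => (F n).dist2 ((1 - a) * t n)) atTop atTop

/-- The family `F` has an `L²`-cutoff. -/
def HasL2Cutoff {S : ℕ → Type*} [∀ n, Fintype (S n)] [∀ n, DecidableEq (S n)]
    (F : ∀ n, RevChain (S n)) : Prop :=
  ∃ t : ℕ → ℝ, IsL2CutoffTime F t

end

/-! In an eigenbasis the squared distance is `D(t) = ∑_{i ≥ 1} w_i e^{-2 lam_i t}` with `w_i =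
|μ(φ_i)|²`; let `W_j` be the partial sums of the weights. The hypothesis says that the total weight
diverges.

Two estimates show that `D` drops near `τ`. Before `τ`, the maximising index `j` alone gives `D(τ -
s) ≥ W_j/(1 + W_j) e^{2 lam_j s}` (`le_distSq_tau_sub`). After `τ`, maximality bounds `e^{-2 lam_i
τ}` by `(1 + W_i)⁻¹` on the tail, and spending half of the extra time `s` improves the exponent to
`-1 - b` with `b = s/(2τ)`, so that the tail sum telescopes to at most `1/b`
(`sum_Ico_weight_mul_exp_le`, `distSq_tau_add_le`). Below the tail, a first block has total weight
at most an arbitrarily small `c`, and a middle block of bounded weight vanishes once `τ lam_{j(c)} →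
∞`; this is why the conditions are imposed for all `c`.

Taking `s = aτ` gives the cutoff and `s = √(τ/lam_{j(c)})` the window. Conversely, weight above `c`
at rates at most `lam_{j(c)}` keeps `D` from vanishing before times of order `1/lam_{j(c)}`, so a
cutoff forces `T lam_{j(c)} → ∞`; the bound `T ≤ 2τ + K/lam` passes this on to `τ`. -/

namespace RevChain

variable {S : Type*} [Fintype S]

/-! ### Irreducibility and the spectral expansion of the distance. -/

theorem nonempty (C : RevChain S) : Nonempty S := by
  by_contra h
  rw [not_nonempty_iff] at h
  simpa using C.μ_sum

theorem card_pos (C : RevChain S) : 0 < Fintype.card S :=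
  have := C.nonempty
  Fintype.card_pos

/-- Some state carries mass, and detailed balance transports positivity along jumps of positive
rate. -/
theorem π_pos (C : RevChain S) (x : S) : 0 < C.π x := by
  obtain ⟨z, hz⟩ : ∃ z, 0 < C.π z := by
    by_contra! h
    have h1 := Finset.sum_nonpos fun x (_ : x ∈ Finset.univ) => h x
    rw [C.π_sum] at h1
    linarith
  induction C.irreducible z x with
  | refl => exact hz
  | @tail u v _ huv ih =>
    refine (C.π_nonneg v).lt_of_ne fun h0 => ?_
    have h1 := C.reversible u v
    rw [← h0, zero_mul] at h1
    exact (mul_pos ih huv.2).ne' h1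

/-- Harmonic functions of an irreducible chain are constant. -/
theorem eq_of_mulVec_eq_zero (C : RevChain S) {f : S → ℝ} (hf : Matrix.mulVec C.L f = 0)
    (x y : S) : f x = f y := by
  have := C.nonempty
  obtain ⟨m, hm⟩ := Finite.exists_max f
  suffices h : ∀ z, f z = f m by rw [h x, h y]
  intro z
  induction C.irreducible m z with
  | refl => rfl
  | @tail u v _ huv ih =>
    have h0 : ∑ y, C.L u y * (f m - f y) = 0 := by
      have h1 : ∑ y, C.L u y * f y = 0 := congrFun hf u
      simp only [mul_sub, Finset.sum_sub_distrib, ← Finset.sum_mul, C.row_sum, h1]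
      ring
    have h2 : ∀ y ∈ Finset.univ, 0 ≤ C.L u y * (f m - f y) := by
      intro y _
      by_cases hy : u = y
      · rw [← hy, ih]; simp
      · exact mul_nonneg (C.rate_nonneg u y hy) (sub_nonneg.2 (hm y))
    have h3 := (Finset.sum_eq_zero_iff_of_nonneg h2).1 h0 v (Finset.mem_univ v)
    rcases mul_eq_zero.1 h3 with h4 | h4
    · exact absurd h4 huv.2.ne'
    · linarith

/-- The weight `|μ(φ_i)|²`. -/
noncomputable def weight (C : RevChain S) (φ : ℕ → S → ℝ) (i : ℕ) : ℝ :=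
  |∑ x, C.μ x * φ i x| ^ 2

theorem weight_nonneg (C : RevChain S) (φ : ℕ → S → ℝ) (i : ℕ) : 0 ≤ C.weight φ i :=
  sq_nonneg _

/-- The spectral expansion `∑_{i ≥ 1} |μ(φ_i)|² e^{-2 lam_i t}` of the squared distance. -/
noncomputable def distSq (C : RevChain S) (lam : ℕ → ℝ) (φ : ℕ → S → ℝ) (t : ℝ) : ℝ :=
  ∑ i ∈ Finset.Ico 1 (Fintype.card S), C.weight φ i * Real.exp (-2 * lam i * t)

namespace IsEigenbasis

variable {C : RevChain S} {lam : ℕ → ℝ} {φ : ℕ → S → ℝ}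

theorem lam_zero (h : C.IsEigenbasis lam φ) : lam 0 = 0 := by
  obtain ⟨x⟩ := C.nonempty
  have h1 := congrFun (h.eigen 0 C.card_pos) x
  rw [h.zero] at h1
  simp only [Matrix.mulVec, dotProduct, Matrix.neg_apply, Pi.smul_apply, smul_eq_mul, mul_one,
    Finset.sum_neg_distrib, C.row_sum] at h1
  linarith

/-- An eigenfunction for the eigenvalue zero is harmonic, hence constant, and a constant orthogonal
to `φ 0 = 1` cannot have norm one. -/
theorem lam_pos (h : C.IsEigenbasis lam φ) {i : ℕ} (h1 : 1 ≤ i) (hi : i < Fintype.card S) :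
    0 < lam i := by
  have h0 : 0 ≤ lam i := h.lam_zero ▸ h.mono 0 i (Nat.zero_le i) hi
  refine h0.lt_of_ne fun hz => ?_
  have he := h.eigen i hi
  rw [← hz, zero_smul, Matrix.neg_mulVec, neg_eq_zero] at he
  obtain ⟨x⟩ := C.nonempty
  have hc : φ i = fun _ => φ i x := funext fun y => C.eq_of_mulVec_eq_zero he y x
  have ho := h.orthonormal i 0 hi C.card_pos
  have hn := h.orthonormal i i hi hi
  rw [if_neg (by omega), h.zero] at ho
  rw [if_pos rfl] at hn
  rw [hc] at ho hn
  simp only [← Finset.mul_sum, C.π_sum, mul_one] at ho hn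
  rw [ho] at hn
  norm_num at hn

/-- Completeness of an orthonormal eigenbasis. -/
theorem complete [DecidableEq S] (h : C.IsEigenbasis lam φ) (x y : S) :
    ∑ i ∈ Finset.range (Fintype.card S), φ i x * φ i y * C.π y = if x = y then 1 else 0 := by
  let e := Fintype.equivFin S
  let A : Matrix S S ℝ := fun x y => φ (e x) y * C.π y
  let B : Matrix S S ℝ := fun x y => φ (e y) x
  have hAB : A * B = 1 := by
    ext a b
    rw [Matrix.mul_apply, Matrix.one_apply]
    have := h.orthonormal (e a) (e b) (e a).2 (e b).2
    simp only [Fin.val_inj, e.apply_eq_iff_eq] at this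
    rw [← this]
    exact Finset.sum_congr rfl fun z _ => by simp only [A, B]; ring
  -- Orthonormality is `A * B = 1`; the matrices are square, so the one-sided inverse is two-sided,
  -- which is completeness.
  have hBA : B * A = 1 := mul_eq_one_comm.1 hAB
  have h1 := congrFun (congrFun hBA x) y
  rw [Matrix.mul_apply, Matrix.one_apply] at h1
  rw [← h1, Finset.sum_range, ← e.sum_comp]
  exact Finset.sum_congr rfl fun z _ => by simp only [A, B]; ring

theorem semigroup_mulVec [DecidableEq S] (h : C.IsEigenbasis lam φ) (t : ℝ) {i : ℕ}
    (hi : i < Fintype.card S) :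
    Matrix.mulVec (C.semigroup t) (φ i) = Real.exp (-lam i * t) • φ i := by
  let : NormedRing (Matrix S S ℝ) := Matrix.linftyOpNormedRing
  let : NormedAlgebra ℝ (Matrix S S ℝ) := Matrix.linftyOpNormedAlgebra
  have hL : Matrix.mulVec (t • C.L) (φ i) = (-lam i * t) • φ i := by
    have h1 := h.eigen i hi
    rw [Matrix.neg_mulVec, neg_eq_iff_eq_neg] at h1
    rw [Matrix.smul_mulVec, h1, ← neg_smul, smul_smul, mul_comm]
  have hpow : ∀ k : ℕ, Matrix.mulVec ((t • C.L) ^ k) (φ i) = (-lam i * t) ^ k • φ i := by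
    intro k
    induction k with
    | zero => simp
    | succ k ih =>
      rw [pow_succ, ← Matrix.mulVec_mulVec, hL, Matrix.mulVec_smul, ih, smul_smul, pow_succ,
        mul_comm]
  have hs := NormedSpace.exp_series_hasSum_exp' (𝕂 := ℝ) (t • C.L)
  have hr := NormedSpace.exp_series_hasSum_exp' (𝕂 := ℝ) (-lam i * t)
  rw [← Real.exp_eq_exp_ℝ] at hr
  let ev : Matrix S S ℝ →+ (S → ℝ) :=
    { toFun := fun M => Matrix.mulVec M (φ i)
      map_zero' := Matrix.zero_mulVec _
      map_add' := fun M N => Matrix.add_mulVec M N _ }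
  have hc : Continuous ev := continuous_id.matrix_mulVec continuous_const
  have h1 := hs.map ev hc
  have h2 := hr.smul_const (φ i)
  refine HasSum.unique h1 ?_
  convert h2 using 2 with k
  simp only [Function.comp_apply, ev, AddMonoidHom.coe_mk, ZeroHom.coe_mk, Matrix.smul_mulVec,
    hpow, smul_smul, smul_eq_mul]

theorem vecMul_semigroup [DecidableEq S] (h : C.IsEigenbasis lam φ) (t : ℝ) (y : S) :
    Matrix.vecMul C.μ (C.semigroup t) y / C.π y =
      ∑ i ∈ Finset.range (Fintype.card S),
        (∑ x, C.μ x * φ i x) * Real.exp (-lam i * t) * φ i y := by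
  have hcol : ∀ x, C.semigroup t x y =
      ∑ i ∈ Finset.range (Fintype.card S), Real.exp (-lam i * t) * φ i x * φ i y * C.π y := by
    intro x
    have h1 : C.semigroup t x y = ∑ z, C.semigroup t x z * (if z = y then 1 else 0) := by simp
    simp only [h1, ← h.complete, Finset.mul_sum]
    rw [Finset.sum_comm]
    refine Finset.sum_congr rfl fun i hi => ?_
    have h2 : ∑ z, C.semigroup t x z * φ i z = Real.exp (-lam i * t) * φ i x :=
      congrFun (h.semigroup_mulVec t (Finset.mem_range.1 hi)) x
    rw [← h2, Finset.sum_mul, Finset.sum_mul]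
    exact Finset.sum_congr rfl fun z _ => by ring
  rw [div_eq_iff (C.π_pos y).ne']
  simp only [Matrix.vecMul, dotProduct, hcol, Finset.mul_sum, Finset.sum_mul]
  rw [Finset.sum_comm]
  exact Finset.sum_congr rfl fun i _ => Finset.sum_congr rfl fun x _ => by ring

theorem parseval (h : C.IsEigenbasis lam φ) {s : Finset ℕ}
    (hs : s ⊆ Finset.range (Fintype.card S)) (a : ℕ → ℝ) :
    ∑ y, |∑ i ∈ s, a i * φ i y| ^ 2 * C.π y = ∑ i ∈ s, a i ^ 2 := by
  have h1 : ∀ y, |∑ i ∈ s, a i * φ i y| ^ 2 * C.π y =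
      ∑ i ∈ s, ∑ j ∈ s, a i * a j * (φ i y * φ j y * C.π y) := by
    intro y
    rw [sq_abs, sq, Finset.sum_mul_sum, Finset.sum_mul]
    refine Finset.sum_congr rfl fun i _ => ?_
    rw [Finset.sum_mul]
    exact Finset.sum_congr rfl fun j _ => by ring
  simp only [h1]
  rw [Finset.sum_comm]
  refine Finset.sum_congr rfl fun i hi => ?_
  rw [Finset.sum_comm]
  simp only [← Finset.mul_sum]
  rw [Finset.sum_congr rfl fun j hj => by
    rw [h.orthonormal i j (Finset.mem_range.1 (hs hi)) (Finset.mem_range.1 (hs hj))]]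
  simp [hi, sq]

theorem dist2_eq [DecidableEq S] (h : C.IsEigenbasis lam φ) (t : ℝ) :
    C.dist2 t = Real.sqrt (C.distSq lam φ t) := by
  unfold dist2 distSq
  congr 1
  have h1 : ∀ y, Matrix.vecMul C.μ (C.semigroup t) y / C.π y - 1 =
      ∑ i ∈ Finset.Ico 1 (Fintype.card S),
        (∑ x, C.μ x * φ i x) * Real.exp (-lam i * t) * φ i y := by
    intro y
    rw [h.vecMul_semigroup, Finset.range_eq_Ico, Finset.sum_eq_sum_Ico_succ_bot C.card_pos,
      h.lam_zero, h.zero]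
    simp [C.μ_sum]
  simp only [h1]
  rw [h.parseval (fun i hi => Finset.mem_range.2 (Finset.mem_Ico.1 hi).2)]
  refine Finset.sum_congr rfl fun i _ => ?_
  rw [weight, sq_abs, mul_pow, ← Real.exp_nat_mul]
  congr 2
  push_cast
  ring

/-- Parseval at time zero; the index `0` contributes `1` because `μ` is a probability. Divergence of
the initial mass thus becomes divergence of the total weight. -/
theorem initialMass_eq (h : C.IsEigenbasis lam φ) :
    C.initialMass = 1 + C.weightSum φ (Fintype.card S - 1) := by
  classical
  have h1 : ∀ y, C.μ y / C.π y =
      ∑ i ∈ Finset.range (Fintype.card S), (∑ x, C.μ x * φ i x) * φ i y := by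
    intro y
    have := h.vecMul_semigroup 0 y
    simpa [semigroup] using this
  unfold initialMass weightSum
  simp only [h1]
  rw [h.parseval subset_rfl, Finset.range_eq_Ico, Finset.sum_eq_sum_Ico_succ_bot C.card_pos,
    h.zero]
  simp only [mul_one, C.μ_sum, sq_abs, one_pow]
  congr 1

end IsEigenbasis

end RevChain

/-! ### Partial sums of the weights and the threshold index. -/

namespace RevChain

variable {S : Type*} [Fintype S]

theorem weightSum_eq (C : RevChain S) (φ : ℕ → S → ℝ) (j : ℕ) :
    C.weightSum φ j = ∑ i ∈ Finset.Icc 1 j, C.weight φ i := rfl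

theorem weightSum_succ (C : RevChain S) (φ : ℕ → S → ℝ) (j : ℕ) :
    C.weightSum φ (j + 1) = C.weightSum φ j + C.weight φ (j + 1) := by
  rw [weightSum_eq, weightSum_eq, Finset.sum_Icc_succ_top (by omega)]

theorem weightSum_nonneg (C : RevChain S) (φ : ℕ → S → ℝ) (j : ℕ) : 0 ≤ C.weightSum φ j :=
  Finset.sum_nonneg fun i _ => C.weight_nonneg φ i

theorem weightSum_mono (C : RevChain S) (φ : ℕ → S → ℝ) : Monotone (C.weightSum φ) :=
  monotone_nat_of_le_succ fun j => by
    rw [weightSum_succ]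
    exact le_add_of_nonneg_right (C.weight_nonneg φ _)

theorem sum_Ico_weight (C : RevChain S) (φ : ℕ → S → ℝ) (j : ℕ) :
    ∑ i ∈ Finset.Ico 1 j, C.weight φ i = C.weightSum φ (j - 1) := by
  rw [weightSum_eq]
  refine Finset.sum_congr ?_ fun _ _ => rfl
  ext i
  simp only [Finset.mem_Ico, Finset.mem_Icc]
  omega

section Index

variable {C : RevChain S} {φ : ℕ → S → ℝ} {c c' : ℝ}

theorem jIndex_spec (h0 : 0 < c) (hc : c < C.weightSum φ (Fintype.card S - 1)) :
    1 ≤ C.jIndex φ c ∧ C.jIndex φ c < Fintype.card S ∧ c < C.weightSum φ (C.jIndex φ c) := by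
  have hne : {j : ℕ | 1 ≤ j ∧ j < Fintype.card S ∧ c < C.weightSum φ j}.Nonempty := by
    refine ⟨Fintype.card S - 1, ?_, by have := C.card_pos; omega, hc⟩
    by_contra h
    have h1 : Fintype.card S - 1 = 0 := by omega
    rw [h1, weightSum_eq] at hc
    simp at hc
    linarith
  exact Nat.sInf_mem hne

theorem weightSum_le_of_lt_jIndex (h0 : 0 ≤ c) {i : ℕ} (hi : i < C.jIndex φ c)
    (hiN : i < Fintype.card S) : C.weightSum φ i ≤ c := by
  by_contra! h
  have h1 : 1 ≤ i := by
    by_contra h2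
    have h3 : i = 0 := by omega
    rw [h3, weightSum_eq] at h
    simp at h
    linarith
  exact Nat.notMem_of_lt_sInf hi ⟨h1, hiN, h⟩

theorem jIndex_mono (h0 : 0 < c) (hcc : c ≤ c')
    (hc : c' < C.weightSum φ (Fintype.card S - 1)) : C.jIndex φ c ≤ C.jIndex φ c' := by
  have h := jIndex_spec (h0.trans_le hcc) hc
  by_contra! hlt
  linarith [weightSum_le_of_lt_jIndex h0.le hlt h.2.1]

end Index

namespace IsEigenbasis

variable {C : RevChain S} {lam : ℕ → ℝ} {φ : ℕ → S → ℝ} {c c' : ℝ}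

theorem lam_jIndex_pos (h : C.IsEigenbasis lam φ) (h0 : 0 < c)
    (hc : c < C.weightSum φ (Fintype.card S - 1)) : 0 < lam (C.jIndex φ c) :=
  h.lam_pos (jIndex_spec h0 hc).1 (jIndex_spec h0 hc).2.1

theorem lam_jIndex_mono (h : C.IsEigenbasis lam φ) (h0 : 0 < c) (hcc : c ≤ c')
    (hc : c' < C.weightSum φ (Fintype.card S - 1)) :
    lam (C.jIndex φ c) ≤ lam (C.jIndex φ c') :=
  h.mono _ _ (jIndex_mono h0 hcc hc) (jIndex_spec (h0.trans_le hcc) hc).2.1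

end IsEigenbasis

/-! ### The maximum defining `tau`. -/

section Tau

variable {C : RevChain S} {lam : ℕ → ℝ} {φ : ℕ → S → ℝ} {c c' : ℝ}

theorem tau_set_finite (C : RevChain S) (lam : ℕ → ℝ) (φ : ℕ → S → ℝ) (c : ℝ) :
    ((fun j : ℕ => Real.log (1 + C.weightSum φ j) / (2 * lam j)) ''
      {j : ℕ | C.jIndex φ c ≤ j ∧ j < Fintype.card S}).Finite :=
  ((Set.finite_lt_nat (Fintype.card S)).subset fun _ hj => hj.2).image _

theorem le_tau {j : ℕ} (hj : C.jIndex φ c ≤ j) (hjN : j < Fintype.card S) :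
    Real.log (1 + C.weightSum φ j) / (2 * lam j) ≤ C.tau lam φ c :=
  le_csSup (tau_set_finite C lam φ c).bddAbove ⟨j, ⟨hj, hjN⟩, rfl⟩

theorem exists_eq_tau (h0 : 0 < c) (hc : c < C.weightSum φ (Fintype.card S - 1)) :
    ∃ j, C.jIndex φ c ≤ j ∧ j < Fintype.card S ∧
      Real.log (1 + C.weightSum φ j) / (2 * lam j) = C.tau lam φ c := by
  have hne : ((fun j : ℕ => Real.log (1 + C.weightSum φ j) / (2 * lam j)) ''
      {j : ℕ | C.jIndex φ c ≤ j ∧ j < Fintype.card S}).Nonempty :=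
    ⟨_, C.jIndex φ c, ⟨le_rfl, (jIndex_spec h0 hc).2.1⟩, rfl⟩
  obtain ⟨j, hj, h⟩ := hne.csSup_mem (tau_set_finite C lam φ c)
  exact ⟨j, hj.1, hj.2, h⟩

namespace IsEigenbasis

theorem tau_pos (h : C.IsEigenbasis lam φ) (h0 : 0 < c)
    (hc : c < C.weightSum φ (Fintype.card S - 1)) : 0 < C.tau lam φ c := by
  have hj := jIndex_spec h0 hc
  refine lt_of_lt_of_le (div_pos (Real.log_pos ?_) ?_) (le_tau le_rfl hj.2.1)
  · linarith
  · have := h.lam_jIndex_pos h0 hc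
    linarith

/-- Lowering the threshold from `c'` to `c` hardly changes `tau`. -/
theorem tau_mul_le (h : C.IsEigenbasis lam φ) (h0 : 0 < c) (hcc : c ≤ c')
    (hc : c' < C.weightSum φ (Fintype.card S - 1)) :
    C.tau lam φ c * lam (C.jIndex φ c) ≤
      max (C.tau lam φ c' * lam (C.jIndex φ c)) (Real.log (1 + c') / 2) := by
  have hc1 := hcc.trans_lt hc
  have hl := h.lam_jIndex_pos h0 hc1
  obtain ⟨j, hj, hjN, hjt⟩ := exists_eq_tau (lam := lam) h0 hc1
  by_cases hjc : C.jIndex φ c' ≤ j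
  · refine le_max_of_le_left (mul_le_mul_of_nonneg_right ?_ hl.le)
    rw [← hjt]
    exact le_tau hjc hjN
  -- A maximiser `j` below the index of `c'` has partial sum at most `c'`, while `lam j` is at least
  -- the eigenvalue at the index of `c`.
  · refine le_max_of_le_right ?_
    have hW := weightSum_le_of_lt_jIndex (h0.le.trans hcc) (not_le.1 hjc) hjN
    have hlj := h.mono _ _ hj hjN
    have hW0 := C.weightSum_nonneg φ j
    have hlog : Real.log (1 + C.weightSum φ j) ≤ Real.log (1 + c') :=
      Real.log_le_log (by linarith) (by linarith)
    have hlog0 : 0 ≤ Real.log (1 + c') := Real.log_nonneg (by linarith)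
    rw [← hjt, div_mul_eq_mul_div, div_le_div_iff₀ (by linarith) two_pos]
    nlinarith [mul_le_mul hlog hlj hl.le hlog0]

end IsEigenbasis

end Tau

/-! ### Bounds for the squared distance and the mixing time. -/

section DistSq

variable {C : RevChain S} {lam : ℕ → ℝ} {φ : ℕ → S → ℝ} {c c' : ℝ}

theorem distSq_nonneg (C : RevChain S) (lam : ℕ → ℝ) (φ : ℕ → S → ℝ) (t : ℝ) :
    0 ≤ C.distSq lam φ t :=
  Finset.sum_nonneg fun i _ => mul_nonneg (C.weight_nonneg φ i) (Real.exp_pos _).le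

theorem continuous_distSq (C : RevChain S) (lam : ℕ → ℝ) (φ : ℕ → S → ℝ) :
    Continuous (C.distSq lam φ) := by
  unfold distSq
  fun_prop

namespace IsEigenbasis

theorem antitone_distSq (h : C.IsEigenbasis lam φ) : Antitone (C.distSq lam φ) := by
  intro s t hst
  refine Finset.sum_le_sum fun i hi => mul_le_mul_of_nonneg_left (Real.exp_le_exp.2 ?_)
    (C.weight_nonneg φ i)
  rw [Finset.mem_Ico] at hi
  nlinarith [h.lam_pos hi.1 hi.2]

theorem tendsto_distSq (h : C.IsEigenbasis lam φ) :
    Tendsto (C.distSq lam φ) atTop (𝓝 0) := by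
  have h1 : Tendsto (fun t => C.distSq lam φ t) atTop
      (𝓝 (∑ i ∈ Finset.Ico 1 (Fintype.card S), C.weight φ i * 0)) := by
    refine tendsto_finsetSum _ fun i hi => Tendsto.const_mul _ ?_
    rw [Finset.mem_Ico] at hi
    refine Real.tendsto_exp_atBot.comp (tendsto_id.const_mul_atTop_of_neg ?_)
    linarith [h.lam_pos hi.1 hi.2]
  simpa using h1

theorem mixingTime_eq [DecidableEq S] (h : C.IsEigenbasis lam φ) {ε : ℝ} (hε : 0 < ε) :
    C.mixingTime ε = sInf {t : ℝ | 0 ≤ t ∧ C.distSq lam φ t ≤ ε ^ 2} := by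
  unfold mixingTime
  congr 1
  ext t
  simp only [Set.mem_ofPred_eq, h.dist2_eq, Real.sqrt_le_left hε.le]

theorem mixingTime_le [DecidableEq S] (h : C.IsEigenbasis lam φ) {ε t : ℝ} (hε : 0 < ε)
    (ht : 0 ≤ t) (hD : C.distSq lam φ t ≤ ε ^ 2) : C.mixingTime ε ≤ t := by
  rw [h.mixingTime_eq hε]
  exact csInf_le ⟨0, fun _ hs => hs.1⟩ ⟨ht, hD⟩

theorem mixingTime_mem [DecidableEq S] (h : C.IsEigenbasis lam φ) {ε : ℝ} (hε : 0 < ε) :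
    0 ≤ C.mixingTime ε ∧ C.distSq lam φ (C.mixingTime ε) ≤ ε ^ 2 := by
  rw [h.mixingTime_eq hε]
  have hcl : IsClosed {t : ℝ | 0 ≤ t ∧ C.distSq lam φ t ≤ ε ^ 2} :=
    isClosed_Ici.inter (isClosed_le (C.continuous_distSq lam φ) continuous_const)
  refine hcl.csInf_mem ?_ ⟨0, fun _ hs => hs.1⟩
  have h1 := h.tendsto_distSq.eventually_lt_const (pow_pos hε 2)
  obtain ⟨t, ht, ht0⟩ := (h1.and (eventually_ge_atTop 0)).exists
  exact ⟨t, ht0, ht.le⟩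

theorem le_mixingTime [DecidableEq S] (h : C.IsEigenbasis lam φ) {ε t : ℝ} (hε : 0 < ε)
    (hD : ε ^ 2 < C.distSq lam φ t) : t ≤ C.mixingTime ε := by
  by_contra! hlt
  linarith [h.antitone_distSq hlt.le, (h.mixingTime_mem hε).2]

/-- The first `j` modes decay no faster than at rate `2 * lam j`; the others are dropped. -/
theorem weightSum_mul_exp_le (h : C.IsEigenbasis lam φ) {j : ℕ} (hj : j < Fintype.card S)
    {t : ℝ} (ht : 0 ≤ t) :
    C.weightSum φ j * Real.exp (-2 * lam j * t) ≤ C.distSq lam φ t := by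
  rw [weightSum_eq, Finset.sum_mul]
  refine le_trans (Finset.sum_le_sum (g := fun i => C.weight φ i * Real.exp (-2 * lam i * t))
    fun i hi => mul_le_mul_of_nonneg_left (Real.exp_le_exp.2 ?_) (C.weight_nonneg φ i))
    (Finset.sum_le_sum_of_subset_of_nonneg ?_ fun i _ _ =>
      mul_nonneg (C.weight_nonneg φ i) (Real.exp_pos _).le)
  · rw [Finset.mem_Icc] at hi
    nlinarith [h.mono i j hi.2 hj]
  · intro i hi
    rw [Finset.mem_Icc] at hi
    rw [Finset.mem_Ico]
    omega

theorem mul_exp_le_distSq (h : C.IsEigenbasis lam φ) (h0 : 0 < c)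
    (hc : c < C.weightSum φ (Fintype.card S - 1)) {t : ℝ} (ht : 0 ≤ t) :
    c * Real.exp (-2 * lam (C.jIndex φ c) * t) ≤ C.distSq lam φ t :=
  have hj := jIndex_spec h0 hc
  (mul_le_mul_of_nonneg_right hj.2.2.le (Real.exp_pos _).le).trans
    (h.weightSum_mul_exp_le hj.2.1 ht)

/-- At the index attaining the maximum, `e^{-2 lam_j τ}` is exactly `(1 + W_j)⁻¹`, and `x/(1 + x)`
is increasing. -/
theorem le_distSq_tau_sub (h : C.IsEigenbasis lam φ) (h0 : 0 < c)
    (hc : c < C.weightSum φ (Fintype.card S - 1)) {s : ℝ} (hs : 0 ≤ s)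
    (hst : s ≤ C.tau lam φ c) :
    c / (1 + c) * Real.exp (2 * lam (C.jIndex φ c) * s) ≤
      C.distSq lam φ (C.tau lam φ c - s) := by
  obtain ⟨j, hj, hjN, hjt⟩ := exists_eq_tau (lam := lam) h0 hc
  have hjs := jIndex_spec h0 hc
  have hl := h.lam_pos (hjs.1.trans hj) hjN
  have hW : c ≤ C.weightSum φ j := hjs.2.2.le.trans (C.weightSum_mono φ hj)
  refine le_trans ?_ (h.weightSum_mul_exp_le hjN (sub_nonneg.2 hst))
  have hlog : 2 * lam j * C.tau lam φ c = Real.log (1 + C.weightSum φ j) := by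
    rw [← hjt]
    field_simp
  have he : Real.exp (-2 * lam j * (C.tau lam φ c - s)) =
      (1 + C.weightSum φ j)⁻¹ * Real.exp (2 * lam j * s) := by
    have h1 : (1 + C.weightSum φ j)⁻¹ = Real.exp (-(2 * lam j * C.tau lam φ c)) := by
      rw [hlog, Real.exp_neg, Real.exp_log (by linarith)]
    rw [h1, ← Real.exp_add]
    congr 1
    ring
  rw [he, ← mul_assoc, ← div_eq_mul_inv]
  refine mul_le_mul ?_ (Real.exp_le_exp.2 ?_) (Real.exp_pos _).le
    (div_nonneg (C.weightSum_nonneg φ j) (by linarith))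
  · rw [div_le_div_iff₀ (by linarith) (by linarith)]
    linarith
  · nlinarith [h.mono _ _ hj hjN]

/-- The spectrum is cut at the indices of `c` and `c'`. By minimality of these indices, the weight
strictly below each is at most the threshold. -/
theorem distSq_le (h : C.IsEigenbasis lam φ) (h0 : 0 < c) (hcc : c ≤ c')
    (hc : c' < C.weightSum φ (Fintype.card S - 1)) {t : ℝ} (ht : 0 ≤ t) :
    C.distSq lam φ t ≤ c + c' * Real.exp (-2 * lam (C.jIndex φ c) * t) +
      ∑ i ∈ Finset.Ico (C.jIndex φ c') (Fintype.card S),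
        C.weight φ i * Real.exp (-2 * lam i * t) := by
  have hj := jIndex_spec h0 (hcc.trans_lt hc)
  have hj' := jIndex_spec (h0.trans_le hcc) hc
  have hjj := jIndex_mono h0 hcc hc
  have hhead : ∀ {a : ℝ}, 0 < a → a < C.weightSum φ (Fintype.card S - 1) →
      ∑ i ∈ Finset.Ico 1 (C.jIndex φ a), C.weight φ i ≤ a := by
    intro a ha ha'
    have := jIndex_spec ha ha'
    rw [sum_Ico_weight]
    exact weightSum_le_of_lt_jIndex ha.le (by omega) (by omega)
  have h1 : ∑ i ∈ Finset.Ico 1 (C.jIndex φ c), C.weight φ i * Real.exp (-2 * lam i * t) ≤ c := by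
    refine le_trans (Finset.sum_le_sum fun i hi => ?_) (hhead h0 (hcc.trans_lt hc))
    rw [Finset.mem_Ico] at hi
    refine mul_le_of_le_one_right (C.weight_nonneg φ i) (Real.exp_le_one_iff.2 ?_)
    nlinarith [h.lam_pos hi.1 (hi.2.trans hj.2.1)]
  have h2 : ∑ i ∈ Finset.Ico (C.jIndex φ c) (C.jIndex φ c'),
      C.weight φ i * Real.exp (-2 * lam i * t) ≤
        c' * Real.exp (-2 * lam (C.jIndex φ c) * t) := by
    refine le_trans (Finset.sum_le_sum (g := fun i => C.weight φ i *
      Real.exp (-2 * lam (C.jIndex φ c) * t)) fun i hi =>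
        mul_le_mul_of_nonneg_left (Real.exp_le_exp.2 ?_) (C.weight_nonneg φ i)) ?_
    · rw [Finset.mem_Ico] at hi
      nlinarith [h.mono _ _ hi.1 (hi.2.trans hj'.2.1)]
    · rw [← Finset.sum_mul]
      refine mul_le_mul_of_nonneg_right (le_trans ?_ (hhead (h0.trans_le hcc) hc))
        (Real.exp_pos _).le
      exact Finset.sum_le_sum_of_subset_of_nonneg (Finset.Ico_subset_Ico_left hj.1)
        fun i _ _ => C.weight_nonneg φ i
  unfold distSq
  rw [← Finset.sum_Ico_consecutive _ hj'.1 hj'.2.1.le, ← Finset.sum_Ico_consecutive _ hj.1 hjj]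
  gcongr

theorem distSq_add_le (h : C.IsEigenbasis lam φ) (h0 : 0 < c) (hcc : c ≤ c')
    (hc : c' < C.weightSum φ (Fintype.card S - 1)) {t s : ℝ} (ht : 0 ≤ t) (hs : 0 ≤ s) :
    C.distSq lam φ (t + s) ≤ c + c' * Real.exp (-2 * lam (C.jIndex φ c) * t) +
      Real.exp (-2 * lam (C.jIndex φ c') * s) * C.distSq lam φ t := by
  have hj' := jIndex_spec (h0.trans_le hcc) hc
  have hl := h.lam_jIndex_pos h0 (hcc.trans_lt hc)
  refine (h.distSq_le h0 hcc hc (add_nonneg ht hs)).trans (add_le_add (add_le_add le_rfl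
    (mul_le_mul_of_nonneg_left (Real.exp_le_exp.2 ?_) (h0.le.trans hcc))) ?_)
  · nlinarith
  · unfold distSq
    rw [Finset.mul_sum]
    refine le_trans (Finset.sum_le_sum fun i hi => ?_)
      (Finset.sum_le_sum_of_subset_of_nonneg (Finset.Ico_subset_Ico_left hj'.1) fun i _ _ =>
        mul_nonneg (Real.exp_pos _).le (mul_nonneg (C.weight_nonneg φ i) (Real.exp_pos _).le))
    rw [Finset.mem_Ico] at hi
    rw [mul_left_comm, ← Real.exp_add]
    refine mul_le_mul_of_nonneg_left (Real.exp_le_exp.2 ?_) (C.weight_nonneg φ i)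
    nlinarith [h.mono _ _ hi.1 hi.2]

end IsEigenbasis

end DistSq

/-! ### The upper bound after time `tau`. -/

/-- A discrete form of `∫ (1 + x) ^ (-1 - b) dx ≤ 1 / b`. -/
theorem mul_exp_neg_log_le {W w b : ℝ} (hW : 0 ≤ W) (hw : 0 ≤ w) (hb : 0 < b) :
    w * Real.exp (-(1 + b) * Real.log (1 + (W + w))) ≤
      (Real.exp (-b * Real.log (1 + W)) - Real.exp (-b * Real.log (1 + (W + w)))) / b := by
  set u := Real.log (1 + W)
  set v := Real.log (1 + (W + w)) with hv
  have h1 : Real.exp (-(1 + b) * v) = Real.exp (-b * v) * (1 + (W + w))⁻¹ := by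
    rw [← Real.exp_log (show 0 < 1 + (W + w) by linarith), ← hv, ← Real.exp_neg, ← Real.exp_add]
    congr 1
    ring
  have h2 : Real.exp (-b * u) = Real.exp (-b * v) * Real.exp (b * (v - u)) := by
    rw [← Real.exp_add]
    congr 1
    ring
  -- This is `1 - 1/x ≤ log x` at `x = (1 + W + w)/(1 + W)`.
  have h3 : w * (1 + (W + w))⁻¹ ≤ v - u := by
    have h4 := Real.one_sub_inv_le_log_of_pos
      (show 0 < (1 + (W + w)) / (1 + W) from div_pos (by linarith) (by linarith))
    rw [Real.log_div (by linarith) (by linarith)] at h4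
    refine le_trans (le_of_eq ?_) h4
    have h5 : 1 + W ≠ 0 := by linarith
    have h6 : 1 + (W + w) ≠ 0 := by linarith
    field_simp
    ring
  have h7 := Real.add_one_le_exp (b * (v - u))
  rw [le_div_iff₀ hb, h1, h2]
  have h8 := Real.exp_pos (-b * v)
  nlinarith [mul_le_mul_of_nonneg_left (mul_le_mul_of_nonneg_left h3 hb.le) h8.le,
    mul_le_mul_of_nonneg_left h7 h8.le]

theorem sum_Ico_weight_mul_exp_le (C : RevChain S) (φ : ℕ → S → ℝ) {b : ℝ} (hb : 0 < b) {j : ℕ}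
    (hj : 1 ≤ j) (N : ℕ) :
    ∑ i ∈ Finset.Ico j N, C.weight φ i * Real.exp (-(1 + b) * Real.log (1 + C.weightSum φ i)) ≤
      1 / b := by
  -- The shift by one makes `f (i + 1) - f i` the increment from `W_{i-1}` to `W_i`, so the sum
  -- telescopes; `1 ≤ j` keeps the truncated subtraction harmless.
  let f : ℕ → ℝ := fun k => -Real.exp (-b * Real.log (1 + C.weightSum φ (k - 1))) / b
  have hterm : ∀ i ∈ Finset.Ico j N,
      C.weight φ i * Real.exp (-(1 + b) * Real.log (1 + C.weightSum φ i)) ≤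
        f (i + 1) - f i := by
    intro i hi
    obtain ⟨k, rfl⟩ : ∃ k, i = k + 1 := ⟨i - 1, by have := (Finset.mem_Ico.1 hi).1; omega⟩
    simp only [f, Nat.add_sub_cancel]
    rw [weightSum_succ]
    refine (mul_exp_neg_log_le (C.weightSum_nonneg φ k) (C.weight_nonneg φ (k + 1)) hb).trans
      (le_of_eq ?_)
    ring
  rcases le_or_gt N j with hN | hN
  · rw [Finset.Ico_eq_empty (by omega), Finset.sum_empty]
    positivity
  refine (Finset.sum_le_sum hterm).trans ?_
  rw [Finset.sum_Ico_sub f hN.le]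
  simp only [f]
  have h1 : Real.exp (-b * Real.log (1 + C.weightSum φ (j - 1))) ≤ 1 := by
    rw [Real.exp_le_one_iff]
    have := Real.log_nonneg (show 1 ≤ 1 + C.weightSum φ (j - 1) by
      linarith [C.weightSum_nonneg φ (j - 1)])
    nlinarith
  have h2 := Real.exp_pos (-b * Real.log (1 + C.weightSum φ (N - 1)))
  rw [← sub_div]
  gcongr
  linarith

theorem IsEigenbasis.distSq_tau_add_le {C : RevChain S} {lam : ℕ → ℝ} {φ : ℕ → S → ℝ} {c c' : ℝ}
    (h : C.IsEigenbasis lam φ) (h0 : 0 < c) (hcc : c ≤ c')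
    (hc : c' < C.weightSum φ (Fintype.card S - 1)) {s : ℝ} (hs : 0 < s) :
    C.distSq lam φ (C.tau lam φ c' + s) ≤
      c + c' * Real.exp (-2 * lam (C.jIndex φ c) * C.tau lam φ c') +
        Real.exp (-lam (C.jIndex φ c') * s) * (2 * C.tau lam φ c' / s) := by
  have hj' := jIndex_spec (h0.trans_le hcc) hc
  have hl := h.lam_jIndex_pos h0 (hcc.trans_lt hc)
  have ht := h.tau_pos (h0.trans_le hcc) hc
  set t := C.tau lam φ c' with htdef
  refine (h.distSq_le h0 hcc hc (add_nonneg ht.le hs.le)).trans (add_le_add (add_le_add le_rfl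
    (mul_le_mul_of_nonneg_left (Real.exp_le_exp.2 ?_) (h0.le.trans hcc))) ?_)
  · nlinarith
  -- With `b = s/(2t)`, the bound `log (1 + W_i) ≤ 2 lam_i t` gives `(1 + b) log (1 + W_i) ≤ 2 lam_i
  -- t + lam_i s`. The unused `lam_i s` supplies the exponential prefactor.
  · have hb : 0 < s / (2 * t) := by positivity
    have h1 := C.sum_Ico_weight_mul_exp_le φ hb hj'.1 (Fintype.card S)
    rw [one_div_div] at h1
    refine le_trans ?_ (mul_le_mul_of_nonneg_left h1 (Real.exp_pos _).le)
    rw [Finset.mul_sum]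
    refine Finset.sum_le_sum fun i hi => ?_
    rw [Finset.mem_Ico] at hi
    rw [mul_left_comm, ← Real.exp_add]
    refine mul_le_mul_of_nonneg_left (Real.exp_le_exp.2 ?_) (C.weight_nonneg φ i)
    have hli := h.lam_pos (hj'.1.trans hi.1) hi.2
    have h2 : Real.log (1 + C.weightSum φ i) ≤ 2 * lam i * t := by
      have := le_tau (lam := lam) hi.1 hi.2
      rw [div_le_iff₀ (by linarith)] at this
      linarith
    have h3 := h.mono _ _ hi.1 hi.2
    have h4 : (1 + s / (2 * t)) * Real.log (1 + C.weightSum φ i) ≤ 2 * lam i * t + lam i * s := by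
      refine (mul_le_mul_of_nonneg_left h2 (by positivity)).trans (le_of_eq ?_)
      field_simp
    nlinarith

end RevChain

/-! ### Asymptotics along the family. -/

section Family

variable {S : ℕ → Type*} [∀ n, Fintype (S n)] {F : ∀ n, RevChain (S n)}
  {lam : ℕ → ℕ → ℝ} {φ : ∀ n, ℕ → S n → ℝ}

theorem eventually_lt_weightSum (hφ : ∀ n, (F n).IsEigenbasis (lam n) (φ n))
    (hF : Tendsto (fun n => (F n).initialMass) atTop atTop) (c : ℝ) :
    ∀ᶠ n in atTop, c < (F n).weightSum (φ n) (Fintype.card (S n) - 1) := by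
  filter_upwards [hF.eventually_gt_atTop (1 + c)] with n hn
  rw [(hφ n).initialMass_eq] at hn
  linarith

theorem tendsto_const_mul_exp_neg {x : ℕ → ℝ} (hx : Tendsto x atTop atTop) (c : ℝ) {k : ℝ}
    (hk : 0 < k) : Tendsto (fun n => c * Real.exp (-(k * x n))) atTop (𝓝 0) := by
  have h := (Real.tendsto_exp_neg_atTop_nhds_zero.comp (hx.const_mul_atTop hk)).const_mul c
  simpa using h

theorem tendsto_tau_mul_of_forall (hφ : ∀ n, (F n).IsEigenbasis (lam n) (φ n))
    (hF : Tendsto (fun n => (F n).initialMass) atTop atTop) {c' : ℝ} (hc' : 0 < c')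
    (H : ∀ c > 0, Tendsto
      (fun n => (F n).tau (lam n) (φ n) c * lam n ((F n).jIndex (φ n) c)) atTop atTop)
    {c : ℝ} (hc : 0 < c) : Tendsto
      (fun n => (F n).tau (lam n) (φ n) c' * lam n ((F n).jIndex (φ n) c)) atTop atTop := by
  -- The smaller threshold can be compared with both `c` (through the eigenvalue) and `c'` (through
  -- `tau`).
  have hm : 0 < min c c' := lt_min hc hc'
  refine tendsto_atTop.2 fun M => ?_
  filter_upwards [(H _ hm).eventually_gt_atTop (max M (Real.log (1 + c') / 2)),
    eventually_lt_weightSum hφ hF c, eventually_lt_weightSum hφ hF c'] with n h1 h2 h3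
  have h4 := h1.trans_le ((hφ n).tau_mul_le hm (min_le_right _ _) h3)
  have h5 := (hφ n).lam_jIndex_mono hm (min_le_left _ _) h2
  have h6 := mul_le_mul_of_nonneg_left h5 ((hφ n).tau_pos hc' h3).le
  rw [max_lt_iff, lt_max_iff, lt_max_iff] at h4
  rcases h4.2 with h7 | h7
  · rcases h4.1 with h8 | h8
    · linarith
    · linarith
  · exact absurd h7 (lt_irrefl _)

variable [∀ n, DecidableEq (S n)]

theorem isL2CutoffTime_tau (hφ : ∀ n, (F n).IsEigenbasis (lam n) (φ n))
    (hF : Tendsto (fun n => (F n).initialMass) atTop atTop) {c' : ℝ} (hc' : 0 < c')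
    (H : ∀ c > 0, Tendsto
      (fun n => (F n).tau (lam n) (φ n) c' * lam n ((F n).jIndex (φ n) c)) atTop atTop) :
    IsL2CutoffTime F (fun n => (F n).tau (lam n) (φ n) c') := by
  have hev := eventually_lt_weightSum hφ hF c'
  refine ⟨hev.mono fun n hn => (hφ n).tau_pos hc' hn, fun a ha ha1 => ⟨?_, ?_⟩⟩
  · simp only [(hφ _).dist2_eq]
    rw [← Real.sqrt_zero]
    refine (Real.continuous_sqrt.tendsto 0).comp (tendsto_order.2 ⟨fun b hb =>
      Eventually.of_forall fun n => hb.trans_le ((F n).distSq_nonneg _ _ _), fun η hη => ?_⟩)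
    have hm : 0 < min c' (η / 2) := lt_min hc' (by linarith)
    have h1 := tendsto_const_mul_exp_neg (H _ hm) c' two_pos
    have h2 := tendsto_const_mul_exp_neg (H _ hc') (2 / a) ha
    filter_upwards [hev, h1.eventually_lt_const (show 0 < η / 4 by linarith),
      h2.eventually_lt_const (show 0 < η / 4 by linarith)] with n h3 h4 h5
    have ht := (hφ n).tau_pos hc' h3
    have h6 := (hφ n).distSq_tau_add_le hm (min_le_left _ _) h3 (mul_pos ha ht)
    set t := (F n).tau (lam n) (φ n) c'
    have h7 : 2 * t / (a * t) = 2 / a := by field_simp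
    have h8 : t + a * t = (1 + a) * t := by ring
    rw [h7, h8, mul_comm (Real.exp _) (2 / a)] at h6
    ring_nf at h4 h5 h6 ⊢
    linarith [min_le_right c' (η * (1 / 2))]
  · simp only [(hφ _).dist2_eq]
    refine Real.tendsto_sqrt_atTop.comp ?_
    have h1 : Tendsto (fun n => c' / (1 + c') * Real.exp (2 * a *
        ((F n).tau (lam n) (φ n) c' * lam n ((F n).jIndex (φ n) c')))) atTop atTop :=
      (Real.tendsto_exp_atTop.comp ((H c' hc').const_mul_atTop (by positivity))).const_mul_atTop
        (by positivity)
    refine tendsto_atTop_mono' _ ?_ h1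
    filter_upwards [hev] with n h3
    have ht := (hφ n).tau_pos hc' h3
    have h6 := (hφ n).le_distSq_tau_sub hc' h3 (mul_pos ha ht).le
      (mul_le_of_le_one_left ht.le ha1.le)
    refine le_trans (le_of_eq ?_) (h6.trans (le_of_eq ?_))
    · congr 2
      ring
    · congr 1
      ring

theorem tendsto_mixingTime_mul_of_hasL2Cutoff (hφ : ∀ n, (F n).IsEigenbasis (lam n) (φ n))
    (hF : Tendsto (fun n => (F n).initialMass) atTop atTop) (H : HasL2Cutoff F)
    {ε c : ℝ} (hε : 0 < ε) (hc : 0 < c) : Tendsto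
      (fun n => (F n).mixingTime ε * lam n ((F n).jIndex (φ n) c)) atTop atTop := by
  obtain ⟨t, htpos, ht⟩ := H
  obtain ⟨h1, h2⟩ := ht (1 / 2) (by norm_num) (by norm_num)
  simp only [(hφ _).dist2_eq] at h1 h2
  refine tendsto_atTop.2 fun M => ?_
  -- At time `3t/2` the squared distance is at least `c e^{-3lt}`, so falling below `c e^{-6M}`
  -- forces `lt > 2M`; the mixing time is at least `t/2`.
  have h3 : 0 < Real.sqrt (c * Real.exp (-(6 * M))) := Real.sqrt_pos.2 (by positivity)
  filter_upwards [htpos, eventually_lt_weightSum hφ hF c, h1.eventually_lt_const h3,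
    h2.eventually_gt_atTop ε] with n hn hcn h4 h5
  have hl := (hφ n).lam_jIndex_pos hc hcn
  set l := lam n ((F n).jIndex (φ n) c)
  have h6 := (hφ n).mul_exp_le_distSq hc hcn (t := (1 + 1 / 2) * t n) (by positivity)
  rw [Real.sqrt_lt_sqrt_iff ((F n).distSq_nonneg _ _ _)] at h4
  have h7 := h6.trans_lt h4
  rw [mul_lt_mul_iff_right₀ hc, Real.exp_lt_exp] at h7
  rw [Real.lt_sqrt hε.le] at h5
  have h8 := (hφ n).le_mixingTime hε h5
  nlinarith [mul_le_mul_of_nonneg_right h8 hl.le]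

theorem exp_neg_abs_log_le {x : ℝ} (hx : 0 < x) : Real.exp (-|Real.log x|) ≤ x := by
  refine (Real.exp_le_exp.2 ?_).trans (Real.exp_log hx).le
  linarith [neg_abs_le (Real.log x)]

/-- The point is `T ≤ 2τ + K/l'`: waiting `τ + K/l'` beyond `τ` leaves at most `ε²/4` from each of
the first two blocks and `2 · ε²/4` from the tail. -/
theorem tendsto_tau_mul_of_mixingTime (hφ : ∀ n, (F n).IsEigenbasis (lam n) (φ n))
    (hF : Tendsto (fun n => (F n).initialMass) atTop atTop) {ε : ℝ} (hε : 0 < ε)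
    (H : ∀ c > 0, Tendsto
      (fun n => (F n).mixingTime ε * lam n ((F n).jIndex (φ n) c)) atTop atTop)
    {c : ℝ} (hc : 0 < c) : Tendsto
      (fun n => (F n).tau (lam n) (φ n) (ε ^ 2 / 4) * lam n ((F n).jIndex (φ n) c))
        atTop atTop := by
  have hc' : 0 < ε ^ 2 / 4 := by positivity
  have hm : 0 < min c (ε ^ 2 / 4) := lt_min hc hc'
  have hK := exp_neg_abs_log_le hc'
  have hK0 := abs_nonneg (Real.log (ε ^ 2 / 4))
  set K := |Real.log (ε ^ 2 / 4)|
  refine tendsto_atTop.2 fun M => ?_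
  filter_upwards [(H _ hm).eventually_ge_atTop (2 * M + K), eventually_lt_weightSum hφ hF c,
    eventually_lt_weightSum hφ hF (ε ^ 2 / 4)] with n h1 h2 h3
  have ht := (hφ n).tau_pos hc' h3
  have hl' := (hφ n).lam_jIndex_pos hc' h3
  have hl0 := (hφ n).lam_jIndex_pos hm ((min_le_right _ _).trans_lt h3)
  have hl1 := (hφ n).lam_jIndex_mono hm (min_le_left _ _) h2
  have hl2 := (hφ n).lam_jIndex_mono hm (min_le_right _ _) h3
  set t := (F n).tau (lam n) (φ n) (ε ^ 2 / 4)
  set l' := lam n ((F n).jIndex (φ n) (ε ^ 2 / 4))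
  set l0 := lam n ((F n).jIndex (φ n) (min c (ε ^ 2 / 4)))
  have hKl : 0 ≤ K / l' := by positivity
  have hs : 0 < t + K / l' := by linarith
  have h4 := (hφ n).distSq_tau_add_le hc' le_rfl h3 hs
  have h5 : Real.exp (-2 * l' * t) ≤ 1 := by
    rw [Real.exp_le_one_iff]
    nlinarith
  have h6 : Real.exp (-l' * (t + K / l')) ≤ ε ^ 2 / 4 := by
    refine (Real.exp_le_exp.2 ?_).trans hK
    have : l' * (K / l') = K := by field_simp
    nlinarith
  have h7 : 2 * t / (t + K / l') ≤ 2 := by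
    rw [div_le_iff₀ hs]
    linarith
  have h8 := mul_le_mul h6 h7 (by positivity) hc'.le
  have h9 := mul_le_mul_of_nonneg_left h5 hc'.le
  have h10 := (hφ n).mixingTime_le hε (add_pos ht hs).le (by linarith)
  have h11 := mul_le_mul_of_nonneg_right h10 hl0.le
  have h12 : K / l' * l0 ≤ K := by
    rw [div_mul_eq_mul_div, div_le_iff₀ hl']
    exact mul_le_mul_of_nonneg_left hl2 hK0
  nlinarith [mul_le_mul_of_nonneg_left hl1 ht.le]

/-- After the `δ`-mixing time, a further `K/l` shrinks the tail by the factor `ε²/(4δ²)`. The slower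
modes are already negligible by that time, so only the tail governs the window. -/
theorem exists_mixingTime_le_add (hφ : ∀ n, (F n).IsEigenbasis (lam n) (φ n))
    (hF : Tendsto (fun n => (F n).initialMass) atTop atTop) {ε δ c : ℝ} (hε : 0 < ε) (hδ : 0 < δ)
    (hc : 0 < c)
    (H : ∀ c > 0, Tendsto
      (fun n => (F n).mixingTime δ * lam n ((F n).jIndex (φ n) c)) atTop atTop) :
    ∃ K : ℝ, 0 ≤ K ∧ ∀ᶠ n in atTop,
      (F n).mixingTime ε ≤ (F n).mixingTime δ + K * (1 / lam n ((F n).jIndex (φ n) c)) := by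
  have hx : 0 < ε ^ 2 / (4 * δ ^ 2) := by positivity
  have hm : 0 < min c (ε ^ 2 / 4) := lt_min hc (by positivity)
  have hK := exp_neg_abs_log_le hx
  have hK0 := abs_nonneg (Real.log (ε ^ 2 / (4 * δ ^ 2)))
  set K := |Real.log (ε ^ 2 / (4 * δ ^ 2))|
  refine ⟨K, hK0, ?_⟩
  filter_upwards [eventually_lt_weightSum hφ hF c,
    (tendsto_const_mul_exp_neg (H _ hm) c two_pos).eventually_lt_const
      (show 0 < ε ^ 2 / 4 by positivity)] with n h1 h2
  have hl := (hφ n).lam_jIndex_pos hc h1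
  obtain ⟨hT0, hT⟩ := (hφ n).mixingTime_mem hδ
  set T := (F n).mixingTime δ
  set l := lam n ((F n).jIndex (φ n) c)
  have hs : 0 ≤ K * (1 / l) := by positivity
  refine (hφ n).mixingTime_le hε (add_nonneg hT0 hs) ?_
  have h3 := (hφ n).distSq_add_le hm (min_le_left _ _) h1 hT0 hs
  have h4 : Real.exp (-2 * l * (K * (1 / l))) ≤ ε ^ 2 / (4 * δ ^ 2) := by
    refine (Real.exp_le_exp.2 ?_).trans hK
    have : -2 * l * (K * (1 / l)) = -2 * K := by field_simp
    linarith
  have h5 := mul_le_mul h4 hT ((F n).distSq_nonneg _ _ _) hx.le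
  have h6 : ε ^ 2 / (4 * δ ^ 2) * δ ^ 2 = ε ^ 2 / 4 := by field_simp
  have h7 : -(2 * (T * lam n ((F n).jIndex (φ n) (min c (ε ^ 2 / 4))))) =
    -2 * lam n ((F n).jIndex (φ n) (min c (ε ^ 2 / 4))) * T := by ring
  rw [h7] at h2
  linarith [min_le_right c (ε ^ 2 / 4), sq_nonneg ε]

theorem eventually_abs_mixingTime_sub_tau_le (hφ : ∀ n, (F n).IsEigenbasis (lam n) (φ n))
    (hF : Tendsto (fun n => (F n).initialMass) atTop atTop) {ε c : ℝ} (hε : 0 < ε) (hc : 0 < c)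
    (H : ∀ c' > 0, Tendsto
      (fun n => (F n).tau (lam n) (φ n) c * lam n ((F n).jIndex (φ n) c')) atTop atTop) :
    ∀ᶠ n in atTop, |(F n).mixingTime ε - (F n).tau (lam n) (φ n) c| ≤
      Real.sqrt ((F n).tau (lam n) (φ n) c / lam n ((F n).jIndex (φ n) c)) := by
  have hm : 0 < min c (ε ^ 2 / 4) := lt_min hc (by positivity)
  have hη : 0 < ε ^ 2 / 4 := by positivity
  -- With `y = √(tl)` and `s = √(t/l)` one has `ls = y` and `sy = t`: the lower bound is of order
  -- `e^{2y}`, the tail is at most `2y e^{-y}`, and `y ≥ 1` ensures `s ≤ t`.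
  have hy := Real.tendsto_sqrt_atTop.comp (H c hc)
  have hlow := (Real.tendsto_exp_atTop.comp (hy.const_mul_atTop two_pos)).const_mul_atTop
    (show 0 < c / (1 + c) by positivity)
  have hup := ((Real.tendsto_pow_mul_exp_neg_atTop_nhds_zero 1).comp hy).const_mul 2
  rw [mul_zero] at hup
  filter_upwards [eventually_lt_weightSum hφ hF c,
    (tendsto_const_mul_exp_neg (H _ hm) c two_pos).eventually_lt_const hη,
    hy.eventually_ge_atTop 1, hlow.eventually_gt_atTop (ε ^ 2),
    hup.eventually_lt_const hη] with n h1 h2 h3 h4 h5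
  have hl := (hφ n).lam_jIndex_pos hc h1
  have ht := (hφ n).tau_pos hc h1
  simp only [Function.comp_apply, pow_one] at h3 h4 h5
  have hlower := (hφ n).le_distSq_tau_sub hc h1
    (s := Real.sqrt ((F n).tau (lam n) (φ n) c / lam n ((F n).jIndex (φ n) c)))
    (Real.sqrt_nonneg _)
  have hupper := (hφ n).distSq_tau_add_le hm (min_le_left _ _) h1
    (s := Real.sqrt ((F n).tau (lam n) (φ n) c / lam n ((F n).jIndex (φ n) c)))
    (Real.sqrt_pos.2 (div_pos ht hl))
  set t := (F n).tau (lam n) (φ n) c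
  set l := lam n ((F n).jIndex (φ n) c)
  set l0 := lam n ((F n).jIndex (φ n) (min c (ε ^ 2 / 4)))
  have hs : Real.sqrt (t / l) = Real.sqrt (t * l) / l := by
    rw [← Real.sqrt_sq hl.le, ← Real.sqrt_div' _ (sq_nonneg l), Real.sqrt_sq hl.le]
    congr 1
    field_simp
  have hyy : Real.sqrt (t * l) ^ 2 = t * l := Real.sq_sqrt (by positivity)
  set s := Real.sqrt (t / l)
  set y := Real.sqrt (t * l)
  have hsl : l * s = y := by rw [hs]; field_simp
  have hsy : s * y = t := by
    rw [hs, div_mul_eq_mul_div, ← sq, hyy]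
    field_simp
  have hspos : 0 < s := by
    rw [hs]
    positivity
  rw [abs_le]
  constructor
  · have h6 := hlower (by nlinarith)
    rw [mul_assoc 2 l s, hsl] at h6
    linarith [(hφ n).le_mixingTime hε (h4.trans_le h6)]
  · have h7 : 2 * t / s = 2 * y := by
      rw [← hsy]
      field_simp
    have h8 : -(2 * (t * l0)) = -2 * l0 * t := by ring
    rw [h7, neg_mul l s, hsl] at hupper
    rw [h8] at h2
    have h9 := (hφ n).mixingTime_le hε (add_pos ht hspos).le (by
      nlinarith [min_le_right c (ε ^ 2 / 4), sq_nonneg ε])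
    linarith

end Family

theorem mainTheorem1 {S : ℕ → Type*} [∀ n, Fintype (S n)] [∀ n, DecidableEq (S n)]
    (F : ∀ n, RevChain (S n))
    (lam : ℕ → ℕ → ℝ) (φ : ∀ n, ℕ → S n → ℝ)
    (hφ : ∀ n, (F n).IsEigenbasis (lam n) (φ n))
    (hF : Tendsto (fun n => (F n).initialMass) atTop atTop) :
    [ HasL2Cutoff F,
      ∀ ε > 0, ∀ c > 0, Tendsto
        (fun n => (F n).mixingTime ε * lam n ((F n).jIndex (φ n) c)) atTop atTop,
      ∃ ε > 0, ∀ c > 0, Tendsto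
        (fun n => (F n).mixingTime ε * lam n ((F n).jIndex (φ n) c)) atTop atTop,
      ∀ c > 0, Tendsto
        (fun n => (F n).tau (lam n) (φ n) c * lam n ((F n).jIndex (φ n) c)) atTop atTop,
      ∀ c' > 0, ∀ c > 0, Tendsto
        (fun n => (F n).tau (lam n) (φ n) c' * lam n ((F n).jIndex (φ n) c)) atTop atTop,
      ∃ c' > 0, ∀ c > 0, Tendsto
        (fun n => (F n).tau (lam n) (φ n) c' * lam n ((F n).jIndex (φ n) c)) atTop atTop
    ].TFAE ∧
    (HasL2Cutoff F →
      (∀ c > 0, IsL2CutoffTime F (fun n => (F n).tau (lam n) (φ n) c)) ∧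
      (∀ ε > 0, ∀ δ > 0, ∀ c > 0,
        (fun n => |(F n).mixingTime ε - (F n).mixingTime δ|) =O[atTop]
          (fun n => 1 / lam n ((F n).jIndex (φ n) c))) ∧
      (∀ ε > 0, ∀ c > 0,
        (fun n => |(F n).mixingTime ε - (F n).tau (lam n) (φ n) c|) =O[atTop]
          (fun n => Real.sqrt
            ((F n).tau (lam n) (φ n) c / lam n ((F n).jIndex (φ n) c))))) := by
  have h12 : HasL2Cutoff F → ∀ ε > 0, ∀ c > 0, Tendsto
      (fun n => (F n).mixingTime ε * lam n ((F n).jIndex (φ n) c)) atTop atTop :=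
    fun H _ hε _ hc => tendsto_mixingTime_mul_of_hasL2Cutoff hφ hF H hε hc
  have h25 : (∀ ε > 0, ∀ c > 0, Tendsto
      (fun n => (F n).mixingTime ε * lam n ((F n).jIndex (φ n) c)) atTop atTop) →
      ∀ c' > 0, ∀ c > 0, Tendsto
        (fun n => (F n).tau (lam n) (φ n) c' * lam n ((F n).jIndex (φ n) c)) atTop atTop := by
    intro H c' hc' c hc
    -- Chosen so that `ε²/4 = c'`.
    have hε : 0 < 2 * Real.sqrt c' := by positivity
    have h := tendsto_tau_mul_of_mixingTime hφ hF hε (H _ hε) hc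
    have h4 : (2 * Real.sqrt c') ^ 2 / 4 = c' := by
      rw [mul_pow, Real.sq_sqrt hc'.le]
      ring
    rwa [h4] at h
  refine ⟨?_, fun H => ⟨fun c hc => isL2CutoffTime_tau hφ hF hc (h25 (h12 H) c hc), ?_, ?_⟩⟩
  · tfae_have 1 → 2 := h12
    tfae_have 2 → 3 := fun H => ⟨1, one_pos, H 1 one_pos⟩
    tfae_have 3 → 6 := fun ⟨ε, hε, H⟩ =>
      ⟨ε ^ 2 / 4, by positivity, fun c hc => tendsto_tau_mul_of_mixingTime hφ hF hε H hc⟩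
    tfae_have 6 → 1 := fun ⟨c', hc', H⟩ => ⟨_, isL2CutoffTime_tau hφ hF hc' H⟩
    tfae_have 2 → 5 := h25
    tfae_have 5 → 4 := fun H c hc => H c hc c hc
    tfae_have 4 → 6 := fun H =>
      ⟨1, one_pos, fun c hc => tendsto_tau_mul_of_forall hφ hF one_pos H hc⟩
    tfae_finish
  · intro ε hε δ hδ c hc
    obtain ⟨K, hK, h1⟩ := exists_mixingTime_le_add hφ hF hε hδ hc (h12 H δ hδ)
    obtain ⟨K', hK', h2⟩ := exists_mixingTime_le_add hφ hF hδ hε hc (h12 H ε hε)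
    refine IsBigO.of_bound (K + K') ?_
    filter_upwards [h1, h2, eventually_lt_weightSum hφ hF c] with n h3 h4 h5
    have hl := one_div_pos.2 ((hφ n).lam_jIndex_pos hc h5)
    rw [Real.norm_eq_abs, abs_abs, Real.norm_of_nonneg hl.le, abs_le]
    constructor <;> nlinarith [mul_nonneg hK hl.le, mul_nonneg hK' hl.le]
  · intro ε hε c hc
    refine IsBigO.of_bound 1 ?_
    filter_upwards [eventually_abs_mixingTime_sub_tau_le hφ hF hε hc (h25 (h12 H) c hc)] with n hn
    rwa [Real.norm_eq_abs, abs_abs, Real.norm_of_nonneg (Real.sqrt_nonneg _), one_mul]
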